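/- Let $\mathcal X$ be a complex Hilbert space, let $B$ be a (densely defined, possibly unbounded) selfadjoint operator in $\mathcal X$ with domain $D(B)$, and let $J$ be a bounded linear operator on $\mathcal X$ with $J^*=-J$ and $J^2=-1$. Put $A=JB$ with $D(A)=D(B)$. Assume Condition $\mathrm P_+$: $\sigma(B)\subset[\delta,\infty)$ for some $\delta>0$. Let $\Lambda=B^{1/2}$ be the nonnegative selfadjoint square root of $B$, and let $\mathcal V=D(\Lambda)$ with the norm $\|X\|_{\mathcal V}=\|\Lambda X\|_{\mathcal X}$. Then $\mathcal V$ is a Hilbert space and $\Lambda:\mathcal V\to\mathcal X$ is unitary, with inverse $\Lambda^{-1}:\mathcal X\to\mathcal V$. Let $H=\Lambda\, iJ\,\Lambda$ with domain $D(H)=\{X\in\mathcal V: J\Lambda X\in\mathcal V\}$. Then the following hold. 1. $H$ is selfadjoint, so that $e^{-iHt}$, $t\in\mathbb R$, the strongly continuous one-parameter unitary group on $\mathcal X$ with generator $-iH$, exists. 2. For every $Z_0\in\mathcal X$, the function $Z(t)=e^{-iHt}Z_0$ is the unique $Z\in C(\mathbb R,\mathcal X)$ with $Z(0)=Z_0$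 and $$iH^{-1}[Z(t)-Z(0)]=\int_0^t Z(s)\,ds\quad\text{for all }t\in\mathbb R .$$ 3. For every $X_0\in\mathcal V$, the function $X(t)=\Lambda^{-1}e^{-iHt}\Lambda X_0$ is the unique $X\in C(\mathbb R,\mathcal V)$ with $X(0)=X_0$ and $$A^{-1}[X(t)-X(0)]=\int_0^t X(s)\,ds\quad\text{for all }t\in\mathbb R ,$$ where the integral converges in $\mathcal V$. 4. The maps $V(t):X_0\mapsto X(t)$, $t\in\mathbb R$, are unitary operators on $\mathcal V$ satisfying $V(0)=1$ and $V(s+t)=V(s)V(t)$ for all $s,t\in\mathbb R$; in particular $\|X(t)\|_{\mathcal V}=\|X_0\|_{\mathcal V}$. -/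

import Mathlib

open scoped InnerProductSpace

noncomputable section

namespace KreinGroup

variable {𝒳 : Type*} [NormedAddCommGroup 𝒳] [InnerProductSpace ℂ 𝒳]

/-- `R` is the (bounded, everywhere defined) resolvent `(T - z)⁻¹` of the unbounded operator `T`. -/
def IsResolventAt (T : 𝒳 →ₗ.[ℂ] 𝒳) (z : ℂ) (R : 𝒳 →L[ℂ] 𝒳) : Prop :=
  (∀ y : 𝒳, ∃ h : R y ∈ T.domain, T ⟨R y, h⟩ - z • R y = y) ∧
    ∀ x : T.domain, R (T x - z • (x : 𝒳)) = x

/-- The spectrum of an unbounded operator: those `z` for which `T - z : D(T) → 𝒳`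
has no bounded inverse defined on all of `𝒳`. -/
def unboundedSpectrum (T : 𝒳 →ₗ.[ℂ] 𝒳) : Set ℂ :=
  {z | ¬ ∃ R : 𝒳 →L[ℂ] 𝒳, IsResolventAt T z R}

/-- Condition `P₊`: `σ(B) ⊆ [δ, ∞)` for some `δ > 0`. -/
def ConditionP (B : 𝒳 →ₗ.[ℂ] 𝒳) : Prop :=
  ∃ δ : ℝ, 0 < δ ∧ unboundedSpectrum B ⊆ ((↑) : ℝ → ℂ) '' Set.Ici δ

/-- The product `g f` of unbounded operators, on its natural domain
`{x ∈ D(f) : f x ∈ D(g)}`. -/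
def pcomp (g f : 𝒳 →ₗ.[ℂ] 𝒳) : 𝒳 →ₗ.[ℂ] 𝒳 where
  domain :=
    { carrier := {x | ∃ h : x ∈ f.domain, f ⟨x, h⟩ ∈ g.domain}
      zero_mem' := ⟨f.domain.zero_mem, by
        have : f ⟨0, f.domain.zero_mem⟩ = 0 := f.map_zero
        rw [this]
        exact g.domain.zero_mem⟩
      add_mem' := by
        rintro x y ⟨hx, hx'⟩ ⟨hy, hy'⟩
        refine ⟨f.domain.add_mem hx hy, ?_⟩
        have := f.map_add ⟨x, hx⟩ ⟨y, hy⟩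
        exact this ▸ g.domain.add_mem hx' hy'
      smul_mem' := by
        rintro c x ⟨hx, hx'⟩
        refine ⟨f.domain.smul_mem c hx, ?_⟩
        have := f.map_smul c ⟨x, hx⟩
        exact this ▸ g.domain.smul_mem c hx' }
  toFun :=
    { toFun := fun x => g ⟨f ⟨x, x.2.1⟩, x.2.2⟩
      map_add' := by
        intro x y
        rw [← g.map_add]
        congr 1
        exact Subtype.ext (f.map_add ⟨x, x.2.1⟩ ⟨y, y.2.1⟩)
      map_smul' := by
        intro c x
        rw [RingHom.id_apply, ← g.map_smul]
        congr 1
        exact Subtype.ext (f.map_smul c ⟨x, x.2.1⟩) }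

theorem mem_pcomp_graph {g f : 𝒳 →ₗ.[ℂ] 𝒳} {x y : 𝒳} :
    (x, y) ∈ (pcomp g f).graph ↔ ∃ z, (x, z) ∈ f.graph ∧ (z, y) ∈ g.graph := by
  simp only [LinearPMap.mem_graph_iff]
  constructor
  · rintro ⟨u, rfl, rfl⟩
    exact ⟨f ⟨u, u.2.1⟩, ⟨⟨u, u.2.1⟩, rfl, rfl⟩, ⟨⟨_, u.2.2⟩, rfl, rfl⟩⟩
  · rintro ⟨z, ⟨u, rfl, rfl⟩, ⟨v, hv, rfl⟩⟩
    have hm : f u ∈ g.domain := hv ▸ v.2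
    refine ⟨⟨u, u.2, hm⟩, rfl, ?_⟩
    change g ⟨f u, hm⟩ = g v
    congr 1
    exact Subtype.ext hv.symm

theorem exists_resolvent_zero {B : 𝒳 →ₗ.[ℂ] 𝒳} (hP : ConditionP B) :
    ∃ R : 𝒳 →L[ℂ] 𝒳, IsResolventAt B 0 R := by
  obtain ⟨δ, hδ, h⟩ := hP
  by_contra h0
  obtain ⟨r, hr, h1⟩ := h (show (0 : ℂ) ∈ unboundedSpectrum B from h0)
  have : r = 0 := by exact_mod_cast h1
  have : δ ≤ r := hr
  linarith

section Sqrt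

variable [CompleteSpace 𝒳]

/-- `Λ` is the square root `B^{1/2}`: a nonnegative selfadjoint operator with `Λ² = B`
(equality of unbounded operators, domains included). -/
structure IsNonnegSqrt (B Λ : 𝒳 →ₗ.[ℂ] 𝒳) : Prop where
  isSelfAdjoint : IsSelfAdjoint Λ
  nonneg : ∀ x : Λ.domain, 0 ≤ (⟪Λ x, (x : 𝒳)⟫_ℂ).re
  sq : pcomp Λ Λ = B

theorem resolvent_nonneg {B : 𝒳 →ₗ.[ℂ] 𝒳} (hB : IsSelfAdjoint B) (hP : ConditionP B)
    {R : 𝒳 →L[ℂ] 𝒳} (hR : IsResolventAt B 0 R) : 0 ≤ R := by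
  have hfa : B.IsFormalAdjoint B := by
    have h := LinearPMap.adjoint_isFormalAdjoint hB.dense_domain
    rwa [LinearPMap.isSelfAdjoint_def.mp hB] at h
  have hsym : (R : 𝒳 →ₗ[ℂ] 𝒳).IsSymmetric := by
    intro x y
    obtain ⟨hx, hx'⟩ := hR.1 x
    obtain ⟨hy, hy'⟩ := hR.1 y
    simp only [zero_smul, sub_zero] at hx' hy'
    have := hfa ⟨R x, hx⟩ ⟨R y, hy⟩
    rw [hx', hy'] at this
    exact this.symm
  have hsa : IsSelfAdjoint R := ContinuousLinearMap.isSelfAdjoint_iff_isSymmetric.mpr hsym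
  obtain ⟨δ, hδ, hspec⟩ := hP
  rw [nonneg_iff_isSelfAdjoint_and_quasispectrumRestricts]
  refine ⟨hsa, QuasispectrumRestricts.nnreal_iff.mpr fun r hr => ?_⟩
  rw [quasispectrum_eq_spectrum_union_zero] at hr
  rcases hr with hr | hr
  swap
  · exact (Set.mem_singleton_iff.mp hr).ge
  by_contra! hneg
  apply hr
  have hr0 : (r : ℂ) ≠ 0 := by exact_mod_cast hneg.ne
  obtain ⟨S, hS⟩ : ∃ S, IsResolventAt B (r : ℂ)⁻¹ S := by
    by_contra hno
    obtain ⟨a, ha, ha'⟩ := hspec (show (r : ℂ)⁻¹ ∈ unboundedSpectrum B from hno)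
    have h1 : a = r⁻¹ := by exact_mod_cast ha'
    have h2 : δ ≤ a := ha
    have h3 := inv_lt_zero.mpr hneg
    linarith
  set w : ℂ := (r : ℂ)⁻¹
  have hwr : w * r = 1 := inv_mul_cancel₀ hr0
  have halg : ∀ x : 𝒳, (algebraMap ℝ (𝒳 →L[ℂ] 𝒳) r) x = (r : ℂ) • x := fun x => by
    rw [Algebra.algebraMap_eq_smul_one]
    simp
  have hRB : ∀ x : B.domain, R (B x) = x := fun x => by simpa using hR.2 x
  let T : 𝒳 →L[ℂ] 𝒳 := w • (1 + w • S)
  have e1 : (algebraMap ℝ (𝒳 →L[ℂ] 𝒳) r - R) * T = 1 := by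
    ext y
    obtain ⟨hs, hs'⟩ := hS.1 y
    have h1 : R y = S y - w • R (S y) := by
      conv_lhs => rw [← hs', map_sub, map_smul, hRB]
    simp only [T, mul_apply_eq_comp, sub_apply, halg,
      smul_apply, add_apply,
      one_apply_eq_self, map_smul, map_add, h1]
    linear_combination (norm := module) hwr • (y + w • S y)
  have e2 : T * (algebraMap ℝ (𝒳 →L[ℂ] 𝒳) r - R) = 1 := by
    ext x
    obtain ⟨hu, hu'⟩ := hR.1 x
    have h1 : S x = R x + w • S (R x) := by
      have := hS.2 ⟨R x, hu⟩
      simp only [zero_smul, sub_zero] at hu'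
      rw [hu', map_sub, map_smul, sub_eq_iff_eq_add] at this
      exact this
    simp only [T, mul_apply_eq_comp, sub_apply, halg,
      smul_apply, add_apply,
      one_apply_eq_self, map_smul, map_sub, h1]
    linear_combination (norm := module) hwr • (x + w • R x + (w * w) • S (R x))
  exact ⟨⟨_, T, e1, e2⟩, rfl⟩

theorem exists_isNonnegSqrt {B : 𝒳 →ₗ.[ℂ] 𝒳} (hB : IsSelfAdjoint B) (hP : ConditionP B) :
    ∃ Λ : 𝒳 →ₗ.[ℂ] 𝒳, IsNonnegSqrt B Λ := by
  obtain ⟨R, hR⟩ := exists_resolvent_zero hP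
  have hR0 := resolvent_nonneg hB hP hR
  have hRB : ∀ y, (R y, y) ∈ B.graph := fun y => by
    obtain ⟨h, h'⟩ := hR.1 y
    rw [LinearPMap.mem_graph_iff]
    exact ⟨⟨R y, h⟩, rfl, by simpa using h'⟩
  have hBR : ∀ {x y}, (x, y) ∈ B.graph → R y = x := fun {x y} h => by
    obtain ⟨u, rfl, rfl⟩ := (LinearPMap.mem_graph_iff _).mp h
    simpa using hR.2 u
  have hRinj : ∀ y, R y = 0 → y = 0 := fun y hy => by
    have h1 := hRB y
    rw [hy] at h1
    exact B.mem_graph_snd_inj h1 B.graph.zero_mem rfl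
  obtain ⟨Q, hQ0, hQQ⟩ : ∃ Q : 𝒳 →L[ℂ] 𝒳, 0 ≤ Q ∧ Q * Q = R :=
    ⟨CFC.sqrt R, CFC.sqrt_nonneg R, CFC.sqrt_mul_sqrt_self R⟩
  have hQQ' : ∀ x, Q (Q x) = R x := fun x => by rw [← hQQ]; rfl
  have hQpos := (ContinuousLinearMap.nonneg_iff_isPositive Q).mp hQ0
  have hQsym : ∀ x y, ⟪Q x, y⟫_ℂ = ⟪x, Q y⟫_ℂ := fun x y => hQpos.isSymmetric x y
  have hQinj : ∀ y, Q y = 0 → y = 0 := fun y hy => hRinj y (by rw [← hQQ', hy, map_zero])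
  set P : 𝒳 →ₗ.[ℂ] 𝒳 := (Q : 𝒳 →ₗ[ℂ] 𝒳).toPMap ⊤
  have hP : LinearMap.ker P.toFun = ⊥ := by
    rw [LinearMap.ker_eq_bot']
    exact fun m hm => Subtype.ext (hQinj m hm)
  set Λ := P.inverse
  have hg : ∀ {x y}, (x, y) ∈ Λ.graph ↔ Q y = x := by
    intro x y
    rw [LinearPMap.inverse_graph hP]
    simp only [Submodule.mem_map, LinearPMap.mem_graph_iff, Prod.exists]
    constructor
    · rintro ⟨a, b, ⟨u, rfl, rfl⟩, h⟩
      obtain ⟨h1, h2⟩ := Prod.ext_iff.mp h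
      exact (congrArg Q h2.symm).trans h1
    · rintro rfl
      exact ⟨y, Q y, ⟨⟨y, trivial⟩, rfl, rfl⟩, rfl⟩
  have happ : ∀ x : Λ.domain, Q (Λ x) = x := fun x => hg.mp (Λ.mem_graph x)
  have hmem : ∀ y, ∃ h : Q y ∈ Λ.domain, Λ ⟨Q y, h⟩ = y := fun y => by
    obtain ⟨u, hu, hu'⟩ := (LinearPMap.mem_graph_iff _).mp (hg.mpr (rfl : Q y = Q y))
    have h : Q y ∈ Λ.domain := by
      have := u.2
      rwa [hu] at this
    refine ⟨h, ?_⟩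
    have hu'' : Λ u = y := hu'
    have e : (⟨Q y, h⟩ : Λ.domain) = u := Subtype.ext hu.symm
    rw [e]
    exact hu''
  have hdense : Dense (Λ.domain : Set 𝒳) := by
    refine hB.dense_domain.mono fun x hx => ?_
    have h1 := hBR (B.mem_graph ⟨x, hx⟩)
    rw [← hQQ'] at h1
    obtain ⟨h, -⟩ := hmem (Q (B ⟨x, hx⟩))
    rw [h1] at h
    exact h
  refine ⟨Λ, ?_, ?_, ?_⟩
  · rw [LinearPMap.isSelfAdjoint_def]
    apply le_antisymm
    · have key : ∀ y : Λ.adjoint.domain, Q (Λ.adjoint y) = y := by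
        intro y
        refine ext_inner_right ℂ fun v => ?_
        obtain ⟨h, h'⟩ := hmem v
        have := LinearPMap.adjoint_isFormalAdjoint hdense y ⟨Q v, h⟩
        rw [h'] at this
        rw [hQsym]; exact this
      rw [← LinearPMap.le_graph_iff]
      rintro ⟨x, y⟩ hxy
      obtain ⟨u, rfl, rfl⟩ := (LinearPMap.mem_graph_iff _).mp hxy
      exact hg.mpr (key u)
    · refine LinearPMap.IsFormalAdjoint.le_adjoint hdense fun x y => ?_
      conv_lhs => rw [← happ y]
      conv_rhs => rw [← happ x]
      exact (hQsym _ _).symm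
  · intro x
    have h1 := hQpos.re_inner_nonneg_right (Λ x)
    rw [happ] at h1
    exact h1
  · apply LinearPMap.eq_of_eq_graph
    ext ⟨x, y⟩
    rw [mem_pcomp_graph]
    simp only [hg]
    constructor
    · rintro ⟨z, rfl, rfl⟩
      rw [hQQ']; exact hRB y
    · intro h
      exact ⟨Q y, by rw [hQQ', hBR h], rfl⟩

/-- `Λ = B^{1/2}`. -/
def opSqrt {B : 𝒳 →ₗ.[ℂ] 𝒳} (hB : IsSelfAdjoint B) (hP : ConditionP B) : 𝒳 →ₗ.[ℂ] 𝒳 :=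
  (exists_isNonnegSqrt hB hP).choose

theorem opSqrt_spec {B : 𝒳 →ₗ.[ℂ] 𝒳} (hB : IsSelfAdjoint B) (hP : ConditionP B) :
    IsNonnegSqrt B (opSqrt hB hP) :=
  (exists_isNonnegSqrt hB hP).choose_spec

variable {B : 𝒳 →ₗ.[ℂ] 𝒳} (hB : IsSelfAdjoint B) (hP : ConditionP B)

/-- The energy space `𝒱`: the domain of `Λ = B^{1/2}`, to be endowed with `‖x‖_𝒱 = ‖Λ x‖`. -/
def EnergySpace : Type _ := (opSqrt hB hP).domain

namespace EnergySpace

instance : AddCommGroup (EnergySpace hB hP) :=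
  inferInstanceAs (AddCommGroup (opSqrt hB hP).domain)

instance : Module ℂ (EnergySpace hB hP) :=
  inferInstanceAs (Module ℂ (opSqrt hB hP).domain)

/-- The inclusion `𝒱 ⊆ 𝒳`. -/
def incl : EnergySpace hB hP →ₗ[ℂ] 𝒳 := (opSqrt hB hP).domain.subtype

/-- `Λ` as a linear map `𝒱 → 𝒳`. -/
def lam : EnergySpace hB hP →ₗ[ℂ] 𝒳 := (opSqrt hB hP).toFun

theorem lam_injective : Function.Injective (lam hB hP) := by
  rw [injective_iff_map_eq_zero]
  intro x hx
  obtain ⟨R, hR⟩ := exists_resolvent_zero hP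
  have h1 : (incl hB hP x, (0 : 𝒳)) ∈ (pcomp (opSqrt hB hP) (opSqrt hB hP)).graph := by
    refine mem_pcomp_graph.mpr ⟨0, ?_, (opSqrt hB hP).graph.zero_mem⟩
    rw [← hx]
    exact (opSqrt hB hP).mem_graph x
  rw [(opSqrt_spec hB hP).sq] at h1
  obtain ⟨u, hu, hu'⟩ := (LinearPMap.mem_graph_iff _).mp h1
  have hu'' : B u = 0 := hu'
  have h2 := hR.2 u
  rw [hu'', zero_smul, sub_zero, map_zero] at h2
  exact Subtype.ext (hu.symm.trans h2.symm)

theorem lam_surjective : Function.Surjective (lam hB hP) := by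
  intro y
  obtain ⟨R, hR⟩ := exists_resolvent_zero hP
  obtain ⟨h, h'⟩ := hR.1 y
  have h1 : (R y, y) ∈ B.graph :=
    (LinearPMap.mem_graph_iff _).mpr ⟨⟨R y, h⟩, rfl, by simpa using h'⟩
  rw [← (opSqrt_spec hB hP).sq, mem_pcomp_graph] at h1
  obtain ⟨z, -, hz⟩ := h1
  obtain ⟨v, -, hv⟩ := (LinearPMap.mem_graph_iff _).mp hz
  exact ⟨v, hv⟩

/-- The energy norm `‖x‖_𝒱 = ‖Λ x‖_𝒳`. -/
instance : NormedAddCommGroup (EnergySpace hB hP) :=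
  NormedAddCommGroup.induced _ _ (lam hB hP) (lam_injective hB hP)

/-- The energy inner product `⟪x, y⟫_𝒱 = ⟪Λ x, Λ y⟫_𝒳`. -/
instance : InnerProductSpace ℂ (EnergySpace hB hP) where
  norm_smul_le c x := by
    change ‖lam hB hP (c • x)‖ ≤ ‖c‖ * ‖lam hB hP x‖
    rw [map_smul, norm_smul]
  inner x y := ⟪lam hB hP x, lam hB hP y⟫_ℂ
  norm_sq_eq_re_inner x := norm_sq_eq_re_inner (𝕜 := ℂ) (lam hB hP x)
  conj_inner_symm x y := inner_conj_symm _ _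
  add_left x y z := by rw [map_add, inner_add_left]
  smul_left x y c := by rw [map_smul, inner_smul_left]

/-- `Λ` as the unitary operator `𝒱 → 𝒳`; its inverse is `Λ⁻¹ : 𝒳 → 𝒱`. -/
def lamIso : EnergySpace hB hP ≃ₗᵢ[ℂ] 𝒳 where
  toLinearEquiv := LinearEquiv.ofBijective (lam hB hP)
    ⟨lam_injective hB hP, lam_surjective hB hP⟩
  norm_map' _ := rfl

instance : CompleteSpace (EnergySpace hB hP) :=
  (completeSpace_congr (e := (lamIso hB hP).toEquiv)
    (lamIso hB hP).isometry.isUniformEmbedding).mpr inferInstance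

end EnergySpace

/-- The Hamilton operator `A = J B`, with domain `D(B)`. -/
def hamiltonOp (B : 𝒳 →ₗ.[ℂ] 𝒳) (J : 𝒳 →L[ℂ] 𝒳) : 𝒳 →ₗ.[ℂ] 𝒳 :=
  (J : 𝒳 →ₗ[ℂ] 𝒳).compPMap B

/-- The Schrödinger operator `H = Λ iJ Λ`, with domain `{x ∈ 𝒱 : J Λ x ∈ 𝒱}`. -/
def schrodingerOp (J : 𝒳 →L[ℂ] 𝒳) : 𝒳 →ₗ.[ℂ] 𝒳 :=
  pcomp (opSqrt hB hP) (((Complex.I • J : 𝒳 →L[ℂ] 𝒳) : 𝒳 →ₗ[ℂ] 𝒳).compPMap (opSqrt hB hP))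

/-- `U t = e^{-iHt}`: a strongly continuous one-parameter unitary group whose generator
(domain included) is `-iH`. -/
structure IsUnitaryGroupOf (H : 𝒳 →ₗ.[ℂ] 𝒳) (U : ℝ → 𝒳 →L[ℂ] 𝒳) : Prop where
  unitary : ∀ t, U t ∈ unitary (𝒳 →L[ℂ] 𝒳)
  zero : U 0 = 1
  add : ∀ s t, U (s + t) = U s * U t
  continuous : ∀ z, Continuous fun t => U t z
  generator : ∀ z w, (z, w) ∈ H.graph ↔ HasDerivAt (fun t => U t z) (-(Complex.I • w)) 0

open scoped Classical in
/-- `e^{-iHt}`, the unitary group of `H` (and `1` for operators that have none). -/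
def expGroup (H : 𝒳 →ₗ.[ℂ] 𝒳) : ℝ → 𝒳 →L[ℂ] 𝒳 :=
  if h : ∃ U, IsUnitaryGroupOf H U then h.choose else fun _ => 1

/-- `X ∈ C(ℝ, 𝒱)` solves `Ẋ = A X` in the sense
`A⁻¹ [X(t) - X(0)] = ∫₀ᵗ X(s) ds` for all real `t`, the integral being taken in `𝒱`. -/
def IsMildSolution (J : 𝒳 →L[ℂ] 𝒳) (X : ℝ → EnergySpace hB hP) : Prop :=
  Continuous X ∧ ∀ t : ℝ,
    ∃ h : EnergySpace.incl hB hP (X t - X 0) ∈ (hamiltonOp B J).inverse.domain,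
      (hamiltonOp B J).inverse ⟨_, h⟩ = EnergySpace.incl hB hP (∫ s in (0 : ℝ)..t, X s)

/-- `Z ∈ C(ℝ, 𝒳)` solves `i Ż = H Z` in the sense
`i H⁻¹ [Z(t) - Z(0)] = ∫₀ᵗ Z(s) ds` for all real `t`. -/
def IsMildSchrodingerSolution (H : 𝒳 →ₗ.[ℂ] 𝒳) (Z : ℝ → 𝒳) : Prop :=
  Continuous Z ∧ ∀ t : ℝ, ∃ h : Z t - Z 0 ∈ H.inverse.domain,
    Complex.I • H.inverse ⟨_, h⟩ = ∫ s in (0 : ℝ)..t, Z s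

/-- `X(t) = Λ⁻¹ e^{-iHt} Λ x`. -/
def kreinFlow (J : 𝒳 →L[ℂ] 𝒳) (t : ℝ) (x : EnergySpace hB hP) : EnergySpace hB hP :=
  (EnergySpace.lamIso hB hP).symm
    (expGroup (schrodingerOp hB hP J) t (EnergySpace.lamIso hB hP x))

end Sqrt

end KreinGroup

end

/-!
Let `L = Λ⁻¹`. Then `H` has the bounded selfadjoint injective inverse `K = -i L J⁻¹ L`, so `H` is
selfadjoint. Since `r e^{-it/r}` extends continuously to `r = 0`, the continuous functional calculus
provides `K e^{-it/K}` although `e^{-it/r}` itself has no continuous extension. Because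
`‖K e^{-it/K} x‖ = ‖K x‖`, the map `K x ↦ K e^{-it/K} x` extends from the dense range of `K` to a
unitary operator of `𝒳`, and this is `e^{-iHt}`. A mild solution satisfies `d/dt (K Z) = -i Z`, so
that `‖K Z‖` is conserved, and uniqueness follows by linearity. Finally `Λ : 𝒱 → 𝒳` carries the mild
solutions of `Ẋ = A X` to those of `i Ż = H Z`, because `A⁻¹ = L² J⁻¹ = L (iK) L⁻¹`.
-/

noncomputable section

namespace KreinGroup

section Resolvent

variable {𝒳 : Type*} [NormedAddCommGroup 𝒳] [InnerProductSpace ℂ 𝒳]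
  {T T' : 𝒳 →ₗ.[ℂ] 𝒳} {R R' : 𝒳 →L[ℂ] 𝒳}

theorem isResolventAt_zero_iff :
    IsResolventAt T 0 R ↔ ∀ x y, (x, y) ∈ T.graph ↔ R y = x := by
  simp only [IsResolventAt, zero_smul, sub_zero, LinearPMap.mem_graph_iff]
  refine ⟨fun ⟨hr, hl⟩ x y => ⟨?_, ?_⟩,
    fun h => ⟨fun y => ?_, fun x => (h x (T x)).mp ⟨x, rfl, rfl⟩⟩⟩
  · rintro ⟨x, rfl, rfl⟩
    exact hl x
  · rintro rfl
    obtain ⟨hy, hy'⟩ := hr y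
    exact ⟨⟨R y, hy⟩, rfl, hy'⟩
  · obtain ⟨x, hx, rfl⟩ := (h (R y) y).mpr rfl
    exact ⟨hx ▸ x.2, congrArg T (Subtype.ext hx.symm)⟩

theorem mem_compPMap_graph {f : 𝒳 →ₗ[ℂ] 𝒳} {x y : 𝒳} :
    (x, y) ∈ (f.compPMap T).graph ↔ ∃ w, (x, w) ∈ T.graph ∧ f w = y := by
  simp only [LinearPMap.mem_graph_iff]
  constructor
  · rintro ⟨u, hu, hu'⟩
    exact ⟨T u, ⟨u, hu, rfl⟩, hu'⟩
  · rintro ⟨_, ⟨u, hu, rfl⟩, rfl⟩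
    exact ⟨u, hu, rfl⟩

theorem denseRange_of_isSelfAdjoint_of_injective [CompleteSpace 𝒳] (hR : IsSelfAdjoint R)
    (hinj : Function.Injective R) : DenseRange R := by
  change Dense ((R : 𝒳 →ₗ[ℂ] 𝒳).range : Set 𝒳)
  rw [Submodule.dense_iff_topologicalClosure_eq_top, Submodule.topologicalClosure_eq_top_iff,
    ContinuousLinearMap.orthogonal_range, ← ContinuousLinearMap.star_eq_adjoint, hR.star_eq]
  exact LinearMap.ker_eq_bot.mpr hinj

namespace IsResolventAt

theorem mem_graph_iff (h : IsResolventAt T 0 R) {x y : 𝒳} : (x, y) ∈ T.graph ↔ R y = x :=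
  isResolventAt_zero_iff.mp h x y

theorem injective (h : IsResolventAt T 0 R) : Function.Injective R := fun _ _ hxy =>
  T.mem_graph_snd_inj (h.mem_graph_iff.mpr hxy) (h.mem_graph_iff.mpr rfl) rfl

theorem inverse_eq (h : IsResolventAt T 0 R) :
    T.inverse = (R : 𝒳 →ₗ[ℂ] 𝒳).toPMap ⊤ := by
  have hker : LinearMap.ker T.toFun = ⊥ := by
    refine LinearMap.ker_eq_bot'.mpr fun x hx => Subtype.ext ?_
    have hx' : R (T x) = x := h.mem_graph_iff.mp (T.mem_graph x)
    rw [← hx', show T x = 0 from hx, map_zero]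
    rfl
  apply LinearPMap.eq_of_eq_graph
  ext ⟨y, x⟩
  rw [LinearPMap.inverse_graph hker, Submodule.mem_map_equiv]
  change (x, y) ∈ T.graph ↔ _
  rw [h.mem_graph_iff]
  simp [LinearPMap.mem_graph_iff]

theorem exists_inverse_apply_iff (h : IsResolventAt T 0 R) {P : 𝒳 → Prop} {y : 𝒳} :
    (∃ hy : y ∈ T.inverse.domain, P (T.inverse ⟨y, hy⟩)) ↔ P (R y) := by
  rw [h.inverse_eq]
  exact ⟨fun ⟨_, hP⟩ => hP, fun hP => ⟨trivial, hP⟩⟩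

theorem isMildSchrodingerSolution_iff {Z : ℝ → 𝒳} (h : IsResolventAt T 0 R) :
    IsMildSchrodingerSolution T Z ↔
      Continuous Z ∧ ∀ t, Complex.I • R (Z t - Z 0) = ∫ s in (0 : ℝ)..t, Z s :=
  and_congr_right' <| forall_congr' fun t =>
    h.exists_inverse_apply_iff (P := fun x => Complex.I • x = ∫ s in (0 : ℝ)..t, Z s)

theorem isMildSchrodingerSolution_sub {Z Z' : ℝ → 𝒳} (h : IsResolventAt T 0 R)
    (hZ : IsMildSchrodingerSolution T Z) (hZ' : IsMildSchrodingerSolution T Z') :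
    IsMildSchrodingerSolution T fun t => Z t - Z' t := by
  rw [h.isMildSchrodingerSolution_iff] at hZ hZ' ⊢
  refine ⟨hZ.1.sub hZ'.1, fun t => ?_⟩
  rw [intervalIntegral.integral_sub (hZ.1.intervalIntegrable _ _) (hZ'.1.intervalIntegrable _ _),
    ← hZ.2, ← hZ'.2, ← smul_sub, ← map_sub, sub_sub_sub_comm]

protected theorem pcomp (h : IsResolventAt T 0 R) (h' : IsResolventAt T' 0 R') :
    IsResolventAt (pcomp T' T) 0 (R * R') := by
  refine isResolventAt_zero_iff.mpr fun x y => ?_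
  simp only [mem_pcomp_graph, h.mem_graph_iff, h'.mem_graph_iff, exists_eq_right',
    mul_apply_eq_comp]

theorem units_compPMap (h : IsResolventAt T 0 R) (u : (𝒳 →L[ℂ] 𝒳)ˣ) :
    IsResolventAt (((u : 𝒳 →L[ℂ] 𝒳) : 𝒳 →ₗ[ℂ] 𝒳).compPMap T) 0
      (R * (↑u⁻¹ : 𝒳 →L[ℂ] 𝒳)) := by
  have hu (w y : 𝒳) : (u : 𝒳 →L[ℂ] 𝒳) w = y ↔ w = (↑u⁻¹ : 𝒳 →L[ℂ] 𝒳) y := by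
    constructor
    · rintro rfl
      exact (DFunLike.congr_fun u.inv_mul w).symm
    · rintro rfl
      exact DFunLike.congr_fun u.mul_inv y
  refine isResolventAt_zero_iff.mpr fun x y => ?_
  simp only [mem_compPMap_graph, ContinuousLinearMap.coe_coe, h.mem_graph_iff, hu,
    exists_eq_right, mul_apply_eq_comp]

variable [CompleteSpace 𝒳]

theorem isSelfAdjoint (h : IsResolventAt T 0 R) (hR : IsSelfAdjoint R) : IsSelfAdjoint T := by
  have happ (x : T.domain) : R (T x) = x := h.mem_graph_iff.mp (T.mem_graph x)
  have hdense : Dense (T.domain : Set 𝒳) := by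
    refine (denseRange_of_isSelfAdjoint_of_injective hR h.injective).mono ?_
    rintro _ ⟨y, rfl⟩
    exact (h.1 y).1
  rw [LinearPMap.isSelfAdjoint_def]
  refine le_antisymm (LinearPMap.le_of_le_graph ?_)
    (LinearPMap.IsFormalAdjoint.le_adjoint hdense fun x y => ?_)
  · rintro ⟨x, y⟩ hxy
    obtain ⟨u, rfl, rfl⟩ := (LinearPMap.mem_graph_iff _).mp hxy
    refine h.mem_graph_iff.mpr (ext_inner_right ℂ fun v => ?_)
    obtain ⟨hv, hv'⟩ := h.1 v
    rw [zero_smul, sub_zero] at hv'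
    calc ⟪R (T.adjoint u), v⟫_ℂ = ⟪T.adjoint u, R v⟫_ℂ := hR.isSymmetric _ _
      _ = ⟪(u : 𝒳), T ⟨R v, hv⟩⟫_ℂ := LinearPMap.adjoint_isFormalAdjoint hdense u ⟨R v, hv⟩
      _ = ⟪(u : 𝒳), v⟫_ℂ := by rw [hv']
  · calc ⟪T x, (y : 𝒳)⟫_ℂ = ⟪T x, R (T y)⟫_ℂ := by rw [happ]
      _ = ⟪R (T x), T y⟫_ℂ := (hR.isSymmetric _ _).symm
      _ = ⟪(x : 𝒳), T y⟫_ℂ := by rw [happ]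

end IsResolventAt

variable [CompleteSpace 𝒳]

theorem exists_isResolventAt_zero_of_bijective (hT : IsSelfAdjoint T)
    (hbij : Function.Bijective T.toFun) :
    ∃ R : 𝒳 →L[ℂ] 𝒳, IsSelfAdjoint R ∧ IsResolventAt T 0 R := by
  let e : T.domain ≃ₗ[ℂ] 𝒳 := LinearEquiv.ofBijective T.toFun hbij
  have hT' : T.IsFormalAdjoint T := by
    have := LinearPMap.adjoint_isFormalAdjoint hT.dense_domain
    rwa [LinearPMap.isSelfAdjoint_def.mp hT] at this
  have hsymm : (T.domain.subtype ∘ₗ e.symm.toLinearMap).IsSymmetric := fun x y => by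
    obtain ⟨u, rfl⟩ := e.surjective x
    obtain ⟨v, rfl⟩ := e.surjective y
    simp only [LinearMap.comp_apply, LinearEquiv.coe_coe, LinearEquiv.symm_apply_apply]
    exact (hT' u v).symm
  -- Hellinger–Toeplitz: an everywhere defined symmetric operator is bounded.
  refine ⟨⟨_, hsymm.continuous⟩, ContinuousLinearMap.isSelfAdjoint_iff_isSymmetric.mpr hsymm,
    fun y => ⟨(e.symm y).2, ?_⟩, fun x => ?_⟩
  · rw [zero_smul, sub_zero]
    exact e.apply_symm_apply y
  · rw [zero_smul, sub_zero]
    exact congrArg Subtype.val (e.symm_apply_apply x)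

end Resolvent

section CFC

theorem continuous_cfc_fun_of_continuous_uncurry {X R A : Type*} {p : A → Prop}
    [TopologicalSpace X] [CommSemiring R] [StarRing R] [MetricSpace R] [IsTopologicalSemiring R]
    [ContinuousStar R] [Ring A] [StarRing A] [TopologicalSpace A] [Algebra R A]
    [ContinuousFunctionalCalculus R A p] {f : X → R → R} (hf : Continuous f.uncurry) (a : A) :
    Continuous fun x => cfc (f x) a := by
  refine continuous_iff_continuousAt.mpr fun x => continuousAt_cfc_fun (fun u hu => ?_)
    (.of_forall fun x => (hf.comp (.prodMk_right x)).continuousOn)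
  obtain ⟨v, hv, hvu⟩ := (ContinuousFunctionalCalculus.isCompact_spectrum (p := p) a)
    |>.mem_uniformity_of_prod hf.continuousOn (Set.mem_univ x) (symm_le_uniformity hu)
  exact Filter.mem_of_superset (nhdsWithin_univ x ▸ hv) hvu

theorem cfc_intervalIntegral {R A : Type*} {p : A → Prop} [RCLike R] [NormedRing A] [StarRing A]
    [NormedAlgebra R A] [NormedSpace ℝ A] [CompleteSpace A] [ContinuousFunctionalCalculus R A p]
    {f : ℝ → R → R} (hf : Continuous f.uncurry) (s t : ℝ) (a : A) (ha : p a := by cfc_tac) :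
    cfc (fun z => ∫ x in s..t, f x z) a = ∫ x in s..t, cfc (f x) a := by
  have hσ := ContinuousFunctionalCalculus.isCompact_spectrum (R := R) (p := p) a
  have hIoc (u v : ℝ) :
      cfc (fun z => ∫ x in Set.Ioc u v, f x z) a = ∫ x in Set.Ioc u v, cfc (f x) a := by
    obtain ⟨C, hC⟩ := (isCompact_Icc (a := u) (b := v)).prod hσ
      |>.exists_bound_of_continuousOn hf.continuousOn
    refine cfc_setIntegral measurableSet_Ioc f (fun _ => C) a hf.continuousOn ?_
      (MeasureTheory.hasFiniteIntegral_const C)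
    exact MeasureTheory.ae_restrict_of_forall_mem measurableSet_Ioc fun x hx z hz =>
      hC (x, z) ⟨Set.Ioc_subset_Icc_self hx, hz⟩
  rcases le_total s t with h | h
  · simpa only [intervalIntegral.integral_of_le h] using hIoc s t
  · simp only [intervalIntegral.integral_of_ge h, cfc_neg, hIoc]

theorem cfc_ofReal_re_eq_self {A : Type*} [CStarAlgebra A] {a : A} (ha : IsSelfAdjoint a) :
    cfc (fun z : ℂ => (z.re : ℂ)) a = a := by
  have : IsStarNormal a := ha.isStarNormal
  conv_rhs => rw [← cfc_id ℂ a]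
  exact cfc_congr fun z hz => (ha.mem_spectrum_eq_re hz).symm

end CFC

section MulExpInv

/-- The function `r ↦ r e^{-it/r}`, with the value `0` at `r = 0`, where it is continuous although
`e^{-it/r}` is not. -/
def mulExpInv (t r : ℝ) : ℂ := r * Complex.exp ((-(t / r) : ℝ) * Complex.I)

theorem norm_mulExpInv (t r : ℝ) : ‖mulExpInv t r‖ = |r| := by
  rw [mulExpInv, norm_mul, Complex.norm_exp_ofReal_mul_I, mul_one, Complex.norm_real,
    Real.norm_eq_abs]

theorem mulExpInv_zero_left (r : ℝ) : mulExpInv 0 r = r := by simp [mulExpInv]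

theorem mulExpInv_zero_right (t : ℝ) : mulExpInv t 0 = 0 := by simp [mulExpInv]

theorem mulExpInv_mul_mulExpInv (s t r : ℝ) :
    mulExpInv s r * mulExpInv t r = r * mulExpInv (s + t) r := by
  have h : ((-((s + t) / r) : ℝ) : ℂ) * Complex.I =
      (-(s / r) : ℝ) * Complex.I + (-(t / r) : ℝ) * Complex.I := by
    push_cast
    ring
  simp only [mulExpInv, h, Complex.exp_add]
  ring

theorem continuous_uncurry_mulExpInv : Continuous mulExpInv.uncurry := by
  refine continuous_iff_continuousAt.mpr fun ⟨t, r⟩ => ?_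
  rcases eq_or_ne r 0 with rfl | hr
  · rw [ContinuousAt, Function.uncurry_apply_pair, mulExpInv_zero_right]
    refine squeeze_zero_norm (fun p => (norm_mulExpInv p.1 p.2).le) ?_
    exact Continuous.tendsto' (by fun_prop) _ _ abs_zero
  · have : ContinuousAt (fun p : ℝ × ℝ => p.1 / p.2) (t, r) :=
      continuousAt_fst.div continuousAt_snd hr
    unfold Function.uncurry mulExpInv
    fun_prop

@[fun_prop]
theorem continuous_mulExpInv (t : ℝ) : Continuous (mulExpInv t) :=
  continuous_uncurry_mulExpInv.comp (.prodMk_right t)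

theorem integral_mulExpInv (t r : ℝ) :
    ∫ s in (0 : ℝ)..t, mulExpInv s r = Complex.I * (r * mulExpInv t r - r * r) := by
  rcases eq_or_ne r 0 with rfl | hr
  · simp [mulExpInv_zero_right]
  have hderiv (s : ℝ) :
      HasDerivAt (fun s => Complex.I * (r * mulExpInv s r)) (mulExpInv s r) s := by
    have hexp : HasDerivAt (fun s : ℝ => ((-(s / r) : ℝ) : ℂ) * Complex.I)
        ((-(1 / r) : ℝ) * Complex.I) s :=
      (((hasDerivAt_id s).div_const r).fun_neg.ofReal_comp).mul_const _
    refine (((hexp.cexp.const_mul (r : ℂ)).const_mul (r : ℂ)).const_mul Complex.I).congr_deriv ?_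
    have hr' : (r : ℂ) ≠ 0 := Complex.ofReal_ne_zero.mpr hr
    unfold mulExpInv
    push_cast
    field_simp
    simp
  rw [intervalIntegral.integral_eq_sub_of_hasDerivAt (fun s _ => hderiv s)
    ((continuous_uncurry_mulExpInv.comp (.prodMk_left r)).intervalIntegrable _ _),
    mulExpInv_zero_left, mul_sub]

end MulExpInv

section CFCMulExpInv

variable {A : Type*} [CStarAlgebra A] {a : A}

/-- `a e^{-it/a}` for a selfadjoint element `a`, which need not be invertible. The functional
calculus is the complex one because `r ↦ r e^{-it/r}` is not real-valued. -/
def cfcMulExpInv (a : A) (t : ℝ) : A := cfc (fun z : ℂ => mulExpInv t z.re) a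

theorem continuous_uncurry_mulExpInv_re :
    Continuous (Function.uncurry fun (t : ℝ) (z : ℂ) => mulExpInv t z.re) :=
  continuous_uncurry_mulExpInv.comp (by fun_prop : Continuous fun p : ℝ × ℂ => (p.1, p.2.re))

theorem continuous_cfcMulExpInv (a : A) : Continuous (cfcMulExpInv a) :=
  continuous_cfc_fun_of_continuous_uncurry continuous_uncurry_mulExpInv_re a

theorem cfcMulExpInv_zero (ha : IsSelfAdjoint a) : cfcMulExpInv a 0 = a := by
  simp only [cfcMulExpInv, mulExpInv_zero_left, cfc_ofReal_re_eq_self ha]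

theorem mul_cfcMulExpInv (ha : IsSelfAdjoint a) (t : ℝ) :
    a * cfcMulExpInv a t = cfc (fun z : ℂ => z.re * mulExpInv t z.re) a := by
  rw [cfc_mul (fun z : ℂ => (z.re : ℂ)) _ a (by fun_prop) (by fun_prop), cfc_ofReal_re_eq_self ha,
    cfcMulExpInv]

theorem cfcMulExpInv_mul_cfcMulExpInv (ha : IsSelfAdjoint a) (s t : ℝ) :
    cfcMulExpInv a s * cfcMulExpInv a t = a * cfcMulExpInv a (s + t) := by
  simp only [mul_cfcMulExpInv ha, ← mulExpInv_mul_mulExpInv]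
  exact (cfc_mul _ _ a (by fun_prop) (by fun_prop)).symm

theorem commute_cfcMulExpInv (ha : IsSelfAdjoint a) (t : ℝ) : Commute a (cfcMulExpInv a t) := by
  have h := cfcMulExpInv_mul_cfcMulExpInv ha t 0
  rw [cfcMulExpInv_zero ha, add_zero] at h
  exact h.symm

theorem star_cfcMulExpInv_mul_self (ha : IsSelfAdjoint a) (t : ℝ) :
    star (cfcMulExpInv a t) * cfcMulExpInv a t = star a * a := by
  have h (t : ℝ) : star (cfcMulExpInv a t) * cfcMulExpInv a t =
      cfc (fun z : ℂ => ((|z.re| : ℝ) : ℂ) ^ 2) a := by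
    rw [cfcMulExpInv, ← cfc_star, ← cfc_mul _ _ a (by fun_prop) (by fun_prop)]
    simp only [Complex.star_def, Complex.conj_mul', norm_mulExpInv]
  rw [h t, ← h 0, cfcMulExpInv_zero ha]

theorem integral_cfcMulExpInv (ha : IsSelfAdjoint a) (t : ℝ) :
    ∫ s in (0 : ℝ)..t, cfcMulExpInv a s = Complex.I • (a * cfcMulExpInv a t - a * a) := by
  have hsq : a * a = cfc (fun z : ℂ => (z.re : ℂ) * z.re) a := by
    simpa only [cfcMulExpInv_zero ha, mulExpInv_zero_left] using mul_cfcMulExpInv ha 0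
  have := ha.isStarNormal
  calc ∫ s in (0 : ℝ)..t, cfcMulExpInv a s
      = cfc (fun z : ℂ => ∫ s in (0 : ℝ)..t, mulExpInv s z.re) a :=
        (cfc_intervalIntegral continuous_uncurry_mulExpInv_re 0 t a).symm
    _ = cfc (fun z : ℂ => Complex.I • (z.re * mulExpInv t z.re - z.re * z.re)) a := by
        simp only [integral_mulExpInv, smul_eq_mul]
    _ = Complex.I • (a * cfcMulExpInv a t - a * a) := by
        rw [cfc_smul _ _ a (by fun_prop), cfc_sub _ _ a (by fun_prop) (by fun_prop),
          mul_cfcMulExpInv ha, hsq]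

end CFCMulExpInv

section ExpInv

variable {𝒳 : Type*} [NormedAddCommGroup 𝒳] [InnerProductSpace ℂ 𝒳] [CompleteSpace 𝒳]
  {K : 𝒳 →L[ℂ] 𝒳}

theorem norm_cfcMulExpInv_apply (hK : IsSelfAdjoint K) (t : ℝ) (x : 𝒳) :
    ‖cfcMulExpInv K t x‖ = ‖K x‖ := by
  rw [← sq_eq_sq₀ (norm_nonneg _) (norm_nonneg _),
    ContinuousLinearMap.apply_norm_sq_eq_inner_adjoint_left,
    ContinuousLinearMap.apply_norm_sq_eq_inner_adjoint_left]
  simp only [← ContinuousLinearMap.star_eq_adjoint, ← ContinuousLinearMap.mul_def,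
    star_cfcMulExpInv_mul_self hK]

/-- The unitary operator `e^{-it/K}`, for an injective bounded selfadjoint operator `K`: the
extension by continuity of `K x ↦ K e^{-it/K} x`. -/
def expInv (K : 𝒳 →L[ℂ] 𝒳) (t : ℝ) : 𝒳 →L[ℂ] 𝒳 :=
  ((cfcMulExpInv K t : 𝒳 →L[ℂ] 𝒳) : 𝒳 →ₗ[ℂ] 𝒳).extendOfNorm (K : 𝒳 →ₗ[ℂ] 𝒳)

variable (hK : IsSelfAdjoint K) (hinj : Function.Injective K)
include hK hinj

theorem expInv_apply_apply (t : ℝ) (x : 𝒳) : expInv K t (K x) = cfcMulExpInv K t x :=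
  LinearMap.extendOfNorm_eq (denseRange_of_isSelfAdjoint_of_injective hK hinj)
    ⟨1, fun x => by simpa using (norm_cfcMulExpInv_apply hK t x).le⟩ x

theorem norm_expInv_apply (t : ℝ) (z : 𝒳) : ‖expInv K t z‖ = ‖z‖ := by
  refine (denseRange_of_isSelfAdjoint_of_injective hK hinj).induction_on z
    (isClosed_eq (by fun_prop) (by fun_prop)) fun x => ?_
  rw [expInv_apply_apply hK hinj, norm_cfcMulExpInv_apply hK]

theorem mul_expInv (t : ℝ) : K * expInv K t = cfcMulExpInv K t := by
  refine DFunLike.coe_injective <| (denseRange_of_isSelfAdjoint_of_injective hK hinj).equalizer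
    (by fun_prop) (by fun_prop) (funext fun x => ?_)
  simp only [Function.comp_apply, mul_apply_eq_comp, expInv_apply_apply hK hinj]
  exact DFunLike.congr_fun (commute_cfcMulExpInv hK t) x

theorem expInv_zero : expInv K 0 = 1 := by
  have h : K * expInv K 0 = K * 1 := by rw [mul_expInv hK hinj, cfcMulExpInv_zero hK, mul_one]
  exact ContinuousLinearMap.ext fun z => hinj (DFunLike.congr_fun h z)

theorem expInv_add (s t : ℝ) : expInv K (s + t) = expInv K s * expInv K t := by
  have h : K * (K * expInv K (s + t)) = K * (K * (expInv K s * expInv K t)) := by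
    calc K * (K * expInv K (s + t)) = cfcMulExpInv K s * cfcMulExpInv K t := by
          rw [mul_expInv hK hinj, cfcMulExpInv_mul_cfcMulExpInv hK]
      _ = K * cfcMulExpInv K s * expInv K t := by
          rw [← mul_expInv hK hinj t, (commute_cfcMulExpInv hK s).eq, mul_assoc]
      _ = K * (K * (expInv K s * expInv K t)) := by
          rw [← mul_expInv hK hinj s, mul_assoc, mul_assoc]
  exact ContinuousLinearMap.ext fun z => hinj (hinj (DFunLike.congr_fun h z))

theorem expInv_mem_unitary (t : ℝ) : expInv K t ∈ unitary (𝒳 →L[ℂ] 𝒳) := by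
  have hstar : star (expInv K t) * expInv K t = 1 :=
    (ContinuousLinearMap.norm_map_iff_adjoint_comp_self _).mp (norm_expInv_apply hK hinj t)
  have hinv : expInv K t * expInv K (-t) = 1 := by
    rw [← expInv_add hK hinj, add_neg_cancel, expInv_zero hK hinj]
  exact Unitary.mem_iff.mpr ⟨hstar, by rw [left_inv_eq_right_inv hstar hinv, hinv]⟩

theorem continuous_expInv_apply (z : 𝒳) : Continuous fun t => expInv K t z := by
  refine continuous_of_uniform_approx_of_continuous fun u hu => ?_
  obtain ⟨ε, hε, hεu⟩ := Metric.mem_uniformity_dist.mp hu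
  obtain ⟨x, hx⟩ := (denseRange_of_isSelfAdjoint_of_injective hK hinj).exists_dist_lt z hε
  refine ⟨fun t => expInv K t (K x), ?_, fun t => hεu ?_⟩
  · simpa only [expInv_apply_apply hK hinj] using
      (continuous_cfcMulExpInv K).clm_apply continuous_const
  · rwa [dist_eq_norm, ← map_sub, norm_expInv_apply hK hinj, ← dist_eq_norm]

theorem integral_expInv_apply (t : ℝ) (z : 𝒳) :
    ∫ s in (0 : ℝ)..t, expInv K s z = Complex.I • (K (expInv K t z) - K z) := by
  have hmul (s : ℝ) : K (expInv K s z) = cfcMulExpInv K s z :=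
    DFunLike.congr_fun (mul_expInv hK hinj s) z
  apply hinj
  calc K (∫ s in (0 : ℝ)..t, expInv K s z)
      = ∫ s in (0 : ℝ)..t, cfcMulExpInv K s z := by
        simp only [← hmul]
        exact (K.intervalIntegral_comp_comm
          ((continuous_expInv_apply hK hinj z).intervalIntegrable 0 t)).symm
    _ = (∫ s in (0 : ℝ)..t, cfcMulExpInv K s) z :=
        (ContinuousLinearMap.intervalIntegral_apply
          ((continuous_cfcMulExpInv K).intervalIntegrable 0 t) z).symm
    _ = K (Complex.I • (K (expInv K t z) - K z)) := by
        rw [integral_cfcMulExpInv hK, hmul, map_smul, map_sub]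
        rfl

theorem hasDerivAt_apply_expInv (t : ℝ) (z : 𝒳) :
    HasDerivAt (fun s => K (expInv K s z)) (-(Complex.I • expInv K t z)) t := by
  have h := (((continuous_expInv_apply hK hinj z).integral_hasStrictDerivAt 0 t).hasDerivAt
    |>.fun_const_smul (-Complex.I)).add_const (K z)
  simpa only [integral_expInv_apply hK hinj, smul_smul, neg_mul, Complex.I_mul_I, neg_neg,
    one_smul, sub_add_cancel, neg_smul] using h

end ExpInv

section UnitaryGroup

variable {𝒳 : Type*} [NormedAddCommGroup 𝒳] [InnerProductSpace ℂ 𝒳] [CompleteSpace 𝒳]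
  {H : 𝒳 →ₗ.[ℂ] 𝒳} {K : 𝒳 →L[ℂ] 𝒳} {U : ℝ → 𝒳 →L[ℂ] 𝒳}

theorem IsResolventAt.isUnitaryGroupOf_expInv (h : IsResolventAt H 0 K) (hK : IsSelfAdjoint K) :
    IsUnitaryGroupOf H (expInv K) where
  unitary := expInv_mem_unitary hK h.injective
  zero := expInv_zero hK h.injective
  add := expInv_add hK h.injective
  continuous := continuous_expInv_apply hK h.injective
  generator z w := by
    have hderiv (z : 𝒳) : HasDerivAt (fun s => K (expInv K s z)) (-(Complex.I • z)) 0 := by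
      simpa only [expInv_zero hK h.injective, one_apply_eq_self] using
        hasDerivAt_apply_expInv hK h.injective 0 z
    have hcomm (s : ℝ) : K (expInv K s w) = expInv K s (K w) := by
      rw [expInv_apply_apply hK h.injective, ← mul_expInv hK h.injective, mul_apply_eq_comp]
    rw [h.mem_graph_iff]
    constructor
    · rintro rfl
      simpa only [hcomm] using hderiv w
    · intro hz
      have hKz : HasDerivAt (fun s => K (expInv K s z)) (K (-(Complex.I • w))) 0 :=
        K.hasFDerivAt.restrictScalars ℝ |>.comp_hasDerivAt (0 : ℝ) hz
      simpa using hKz.unique (hderiv z)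

namespace IsUnitaryGroupOf

protected theorem expGroup (hU : IsUnitaryGroupOf H U) : IsUnitaryGroupOf H (expGroup H) := by
  have h : ∃ U, IsUnitaryGroupOf H U := ⟨U, hU⟩
  rw [KreinGroup.expGroup, dif_pos h]
  exact h.choose_spec

theorem hasDerivAt (hU : IsUnitaryGroupOf H U) {z w : 𝒳} (hzw : (z, w) ∈ H.graph) (t : ℝ) :
    HasDerivAt (fun s => U s z) (-(Complex.I • U t w)) t := by
  have h : HasDerivAt (fun s => U t (U s z)) (U t (-(Complex.I • w))) (t - t) := by
    rw [sub_self]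
    exact (U t).hasFDerivAt.restrictScalars ℝ |>.comp_hasDerivAt (0 : ℝ)
      ((hU.generator z w).mp hzw)
  simpa only [← mul_apply_eq_comp, ← hU.add, add_sub_cancel, map_neg, map_smul] using
    h.comp_sub_const t t

theorem mem_graph_apply (hU : IsUnitaryGroupOf H U) {z w : 𝒳} (hzw : (z, w) ∈ H.graph) (t : ℝ) :
    (U t z, U t w) ∈ H.graph := by
  have h : HasDerivAt (fun s => U s z) (-(Complex.I • U t w)) (0 + t) := by
    rw [zero_add]
    exact hU.hasDerivAt hzw t
  rw [hU.generator]
  simpa only [hU.add, mul_apply_eq_comp] using h.comp_add_const 0 t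

end IsUnitaryGroupOf

namespace IsResolventAt

variable {Z : ℝ → 𝒳}

theorem isMildSchrodingerSolution_apply (h : IsResolventAt H 0 K) (hU : IsUnitaryGroupOf H U)
    (z : 𝒳) : IsMildSchrodingerSolution H fun t => U t z := by
  refine h.isMildSchrodingerSolution_iff.mpr ⟨hU.continuous z, fun t => ?_⟩
  have hgraph : (K z, z) ∈ H.graph := h.mem_graph_iff.mpr rfl
  have hcomm (s : ℝ) : K (U s z) = U s (K z) := h.mem_graph_iff.mp (hU.mem_graph_apply hgraph s)
  have hderiv (s : ℝ) : HasDerivAt (fun s => Complex.I • K (U s z)) (U s z) s := by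
    simpa only [hcomm, smul_neg, smul_smul, Complex.I_mul_I, neg_smul, one_smul, neg_neg] using
      (hU.hasDerivAt hgraph s).fun_const_smul Complex.I
  rw [intervalIntegral.integral_eq_sub_of_hasDerivAt (fun s _ => hderiv s)
    ((hU.continuous z).intervalIntegrable _ _), map_sub, smul_sub]

theorem hasDerivAt_mildSchrodingerSolution (h : IsResolventAt H 0 K)
    (hZ : IsMildSchrodingerSolution H Z) (t : ℝ) :
    HasDerivAt (fun s => K (Z s)) (-(Complex.I • Z t)) t := by
  obtain ⟨hcont, hint⟩ := h.isMildSchrodingerSolution_iff.mp hZ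
  have hderiv := ((hcont.integral_hasStrictDerivAt 0 t).hasDerivAt
    |>.fun_const_smul (-Complex.I)).add_const (K (Z 0))
  simpa only [← hint, map_sub, smul_smul, neg_mul, Complex.I_mul_I, neg_neg, one_smul,
    sub_add_cancel, neg_smul] using hderiv

theorem norm_apply_mildSchrodingerSolution (h : IsResolventAt H 0 K) (hK : IsSelfAdjoint K)
    (hZ : IsMildSchrodingerSolution H Z) (t : ℝ) : ‖K (Z t)‖ = ‖K (Z 0)‖ := by
  have hderiv (t : ℝ) : HasDerivAt (fun s => ⟪K (Z s), K (Z s)⟫_ℂ) 0 t := by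
    have hd := h.hasDerivAt_mildSchrodingerSolution hZ t
    have hsymm : ⟪K (Z t), Z t⟫_ℂ = ⟪Z t, K (Z t)⟫_ℂ := hK.isSymmetric _ _
    refine (hd.inner ℂ hd).congr_deriv ?_
    rw [inner_neg_left, inner_neg_right, inner_smul_left, inner_smul_right, hsymm]
    simp
  have hconst := is_const_of_deriv_eq_zero (fun t => (hderiv t).differentiableAt)
    (fun t => (hderiv t).deriv) t 0
  simp only [inner_self_eq_norm_sq_to_K] at hconst
  exact (sq_eq_sq₀ (norm_nonneg _) (norm_nonneg _)).mp (by exact_mod_cast hconst)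

theorem isMildSchrodingerSolution_iff_eq (h : IsResolventAt H 0 K) (hK : IsSelfAdjoint K)
    (hU : IsUnitaryGroupOf H U) :
    IsMildSchrodingerSolution H Z ↔ Z = fun t => U t (Z 0) := by
  refine ⟨fun hZ => funext fun t => ?_,
    fun hZ => hZ ▸ h.isMildSchrodingerSolution_apply hU (Z 0)⟩
  have hnorm := h.norm_apply_mildSchrodingerSolution hK
    (h.isMildSchrodingerSolution_sub hZ (h.isMildSchrodingerSolution_apply hU (Z 0))) t
  simp only [hU.zero, one_apply_eq_self, sub_self, map_zero, norm_zero, norm_eq_zero] at hnorm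
  exact sub_eq_zero.mp (h.injective (hnorm.trans (map_zero K).symm))

end IsResolventAt

end UnitaryGroup

section Energy

theorem isSelfAdjoint_neg_I_smul_conjugate_inv {A : Type*} [Ring A] [StarRing A] [Algebra ℂ A]
    [StarModule ℂ A] {a : A} {j : Aˣ} (hj : star (j : A) = -j) (ha : IsSelfAdjoint a) :
    IsSelfAdjoint (-Complex.I • (a * (↑j⁻¹ : A) * a)) := by
  have hjinv : star (↑j⁻¹ : A) = -↑j⁻¹ := by
    have hj' : star j = -j := Units.ext hj
    rw [← Units.coe_star, ← Units.val_neg, star_inv, hj', inv_neg]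
  rw [isSelfAdjoint_iff]
  simp only [star_smul, star_mul, ha.star_eq, hjinv, star_neg, Complex.star_def, Complex.conj_I,
    neg_neg, neg_mul, mul_neg, smul_neg, neg_smul, mul_assoc]

variable {𝒳 : Type*} [NormedAddCommGroup 𝒳] [InnerProductSpace ℂ 𝒳] [CompleteSpace 𝒳]
  {B : 𝒳 →ₗ.[ℂ] 𝒳} {L : 𝒳 →L[ℂ] 𝒳} (hB : IsSelfAdjoint B) (hP : ConditionP B)

theorem exists_isResolventAt_opSqrt :
    ∃ L : 𝒳 →L[ℂ] 𝒳, IsSelfAdjoint L ∧ IsResolventAt (opSqrt hB hP) 0 L :=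
  exists_isResolventAt_zero_of_bijective (opSqrt_spec hB hP).isSelfAdjoint
    ⟨EnergySpace.lam_injective hB hP, EnergySpace.lam_surjective hB hP⟩

variable {hB hP}

protected theorem IsResolventAt.schrodingerOp (hL : IsResolventAt (opSqrt hB hP) 0 L)
    (J : (𝒳 →L[ℂ] 𝒳)ˣ) :
    IsResolventAt (schrodingerOp hB hP J) 0 (-Complex.I • (L * (↑J⁻¹ : 𝒳 →L[ℂ] 𝒳) * L)) := by
  have h := (hL.units_compPMap (Units.mk0 Complex.I Complex.I_ne_zero • J)).pcomp hL
  have hinv : ((Units.mk0 Complex.I Complex.I_ne_zero • J)⁻¹ : (𝒳 →L[ℂ] 𝒳)ˣ).val =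
      -Complex.I • (↑J⁻¹ : 𝒳 →L[ℂ] 𝒳) := by
    rw [← Complex.inv_I]
    rfl
  rwa [hinv, mul_smul_comm, smul_mul_assoc] at h

protected theorem IsResolventAt.hamiltonOp (hL : IsResolventAt (opSqrt hB hP) 0 L)
    (J : (𝒳 →L[ℂ] 𝒳)ˣ) :
    IsResolventAt (hamiltonOp B J) 0 (L * L * (↑J⁻¹ : 𝒳 →L[ℂ] 𝒳)) := by
  have h := hL.pcomp hL
  rw [(opSqrt_spec hB hP).sq] at h
  exact h.units_compPMap J

theorem IsResolventAt.apply_lamIso (hL : IsResolventAt (opSqrt hB hP) 0 L)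
    (x : EnergySpace hB hP) :
    L (EnergySpace.lamIso hB hP x) = EnergySpace.incl hB hP x :=
  hL.mem_graph_iff.mp ((opSqrt hB hP).mem_graph x)

variable (hB hP) in
theorem exists_isResolventAt_schrodingerOp {J : (𝒳 →L[ℂ] 𝒳)ˣ}
    (hJ : ContinuousLinearMap.adjoint (J : 𝒳 →L[ℂ] 𝒳) = -J) :
    ∃ K : 𝒳 →L[ℂ] 𝒳, IsSelfAdjoint K ∧ IsResolventAt (schrodingerOp hB hP J) 0 K :=
  have ⟨_, hLsa, hL⟩ := exists_isResolventAt_opSqrt hB hP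
  ⟨_, isSelfAdjoint_neg_I_smul_conjugate_inv hJ hLsa, hL.schrodingerOp J⟩

theorem isMildSolution_iff (J : (𝒳 →L[ℂ] 𝒳)ˣ) {X : ℝ → EnergySpace hB hP} :
    IsMildSolution hB hP J X ↔
      IsMildSchrodingerSolution (schrodingerOp hB hP J)
        fun t => EnergySpace.lamIso hB hP (X t) := by
  obtain ⟨L, -, hL⟩ := exists_isResolventAt_opSqrt hB hP
  rw [(hL.schrodingerOp J).isMildSchrodingerSolution_iff]
  refine and_congr (EnergySpace.lamIso hB hP).comp_continuous_iff.symm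
    (forall_congr' fun t => ?_)
  have hleft : L (Complex.I • (-Complex.I • (L * (↑J⁻¹ : 𝒳 →L[ℂ] 𝒳) * L))
        (EnergySpace.lamIso hB hP (X t) - EnergySpace.lamIso hB hP (X 0))) =
      (L * L * (↑J⁻¹ : 𝒳 →L[ℂ] 𝒳)) (EnergySpace.incl hB hP (X t - X 0)) := by
    rw [← map_sub, ← hL.apply_lamIso]
    simp [smul_smul]
  have hright : ∫ s in (0 : ℝ)..t, EnergySpace.lamIso hB hP (X s) =
      EnergySpace.lamIso hB hP (∫ s in (0 : ℝ)..t, X s) :=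
    (EnergySpace.lamIso hB hP).toLinearIsometry.intervalIntegral_comp_comm X
  rw [hright, ← hL.injective.eq_iff, hleft, hL.apply_lamIso]
  exact (hL.hamiltonOp J).exists_inverse_apply_iff
    (P := fun x => x = EnergySpace.incl hB hP (∫ s in (0 : ℝ)..t, X s))

end Energy

section KreinFlow

variable {𝒳 : Type*} [NormedAddCommGroup 𝒳] [InnerProductSpace ℂ 𝒳] [CompleteSpace 𝒳]
  {B : 𝒳 →ₗ.[ℂ] 𝒳} {hB : IsSelfAdjoint B} {hP : ConditionP B}

theorem isMildSolution_iff_eq_kreinFlow {J : (𝒳 →L[ℂ] 𝒳)ˣ} {K : 𝒳 →L[ℂ] 𝒳}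
    (hK : IsSelfAdjoint K) (hH : IsResolventAt (schrodingerOp hB hP J) 0 K)
    (hU : IsUnitaryGroupOf (schrodingerOp hB hP J) (expGroup (schrodingerOp hB hP J)))
    {X : ℝ → EnergySpace hB hP} :
    IsMildSolution hB hP J X ↔ X = fun t => kreinFlow hB hP J t (X 0) := by
  rw [isMildSolution_iff, hH.isMildSchrodingerSolution_iff_eq hK hU]
  simp only [funext_iff, kreinFlow, LinearIsometryEquiv.eq_symm_apply]

variable {J : 𝒳 →L[ℂ] 𝒳}
  (hU : IsUnitaryGroupOf (schrodingerOp hB hP J) (expGroup (schrodingerOp hB hP J)))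

/-- The unitary operator `V(t) = Λ⁻¹ e^{-iHt} Λ` on the energy space. -/
def kreinFlowEquiv (t : ℝ) : EnergySpace hB hP ≃ₗᵢ[ℂ] EnergySpace hB hP :=
  ((EnergySpace.lamIso hB hP).trans (Unitary.linearIsometryEquiv ⟨_, hU.unitary t⟩)).trans
    (EnergySpace.lamIso hB hP).symm

include hU

theorem kreinFlow_zero (x : EnergySpace hB hP) : kreinFlow hB hP J 0 x = x := by
  simp [kreinFlow, hU.zero]

theorem kreinFlow_add (s t : ℝ) (x : EnergySpace hB hP) :
    kreinFlow hB hP J (s + t) x = kreinFlow hB hP J s (kreinFlow hB hP J t x) := by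
  simp [kreinFlow, hU.add]

end KreinFlow

end KreinGroup

end

theorem lemma2p3_general {𝒳 : Type*} [NormedAddCommGroup 𝒳] [InnerProductSpace ℂ 𝒳]
    [CompleteSpace 𝒳] (B : 𝒳 →ₗ.[ℂ] 𝒳) (J : 𝒳 →L[ℂ] 𝒳) (hB : IsSelfAdjoint B)
    (hJ : ContinuousLinearMap.adjoint J = -J) (hJu : IsUnit J) (hP : KreinGroup.ConditionP B) :
    (IsSelfAdjoint (KreinGroup.schrodingerOp hB hP J) ∧
      KreinGroup.IsUnitaryGroupOf (KreinGroup.schrodingerOp hB hP J)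
        (KreinGroup.expGroup (KreinGroup.schrodingerOp hB hP J))) ∧
    (∀ z₀ : 𝒳,
      KreinGroup.IsMildSchrodingerSolution (KreinGroup.schrodingerOp hB hP J)
        (fun t => KreinGroup.expGroup (KreinGroup.schrodingerOp hB hP J) t z₀) ∧
      ∀ Z : ℝ → 𝒳,
        KreinGroup.IsMildSchrodingerSolution (KreinGroup.schrodingerOp hB hP J) Z → Z 0 = z₀ →
          Z = fun t => KreinGroup.expGroup (KreinGroup.schrodingerOp hB hP J) t z₀) ∧
    (∀ x₀ : KreinGroup.EnergySpace hB hP,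
      KreinGroup.kreinFlow hB hP J 0 x₀ = x₀ ∧
      KreinGroup.IsMildSolution hB hP J (fun t => KreinGroup.kreinFlow hB hP J t x₀) ∧
      ∀ X : ℝ → KreinGroup.EnergySpace hB hP,
        KreinGroup.IsMildSolution hB hP J X → X 0 = x₀ →
          X = fun t => KreinGroup.kreinFlow hB hP J t x₀) ∧
    (∃ V : ℝ → (KreinGroup.EnergySpace hB hP ≃ₗᵢ[ℂ] KreinGroup.EnergySpace hB hP),
      (∀ t x, V t x = KreinGroup.kreinFlow hB hP J t x) ∧
      V 0 = LinearIsometryEquiv.refl ℂ (KreinGroup.EnergySpace hB hP) ∧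
      ∀ s t x, V (s + t) x = V s (V t x)) := by
  obtain ⟨J, rfl⟩ := hJu
  obtain ⟨K, hK, hH⟩ := KreinGroup.exists_isResolventAt_schrodingerOp hB hP hJ
  have hU := (hH.isUnitaryGroupOf_expInv hK).expGroup
  have hflow0 := KreinGroup.kreinFlow_zero hU
  have hZ (Z) := hH.isMildSchrodingerSolution_iff_eq hK hU (Z := Z)
  have hX (X) := KreinGroup.isMildSolution_iff_eq_kreinFlow hK hH hU (X := X)
  refine ⟨⟨hH.isSelfAdjoint hK, hU⟩,
    fun z₀ => ⟨hH.isMildSchrodingerSolution_apply hU z₀, fun Z h h0 => h0 ▸ (hZ Z).mp h⟩,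
    fun x₀ => ⟨hflow0 x₀, (hX _).mpr (by rw [hflow0]), fun X h h0 => h0 ▸ (hX X).mp h⟩,
    KreinGroup.kreinFlowEquiv hU, fun _ _ => rfl, LinearIsometryEquiv.ext hflow0,
    KreinGroup.kreinFlow_add hU⟩

theorem lemma2p3 {𝒳 : Type*} [NormedAddCommGroup 𝒳] [InnerProductSpace ℂ 𝒳] [CompleteSpace 𝒳]
    (B : 𝒳 →ₗ.[ℂ] 𝒳) (J : 𝒳 →L[ℂ] 𝒳) (hB : IsSelfAdjoint B)
    (hJ : ContinuousLinearMap.adjoint J = -J) (hJ2 : J ∘L J = -1)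
    (hP : KreinGroup.ConditionP B) :
    -- `H` is selfadjoint and has the group `e^{-iHt}`
    (IsSelfAdjoint (KreinGroup.schrodingerOp hB hP J) ∧
      KreinGroup.IsUnitaryGroupOf (KreinGroup.schrodingerOp hB hP J)
        (KreinGroup.expGroup (KreinGroup.schrodingerOp hB hP J))) ∧
    -- the Schrödinger equation
    (∀ z₀ : 𝒳,
      KreinGroup.IsMildSchrodingerSolution (KreinGroup.schrodingerOp hB hP J)
        (fun t => KreinGroup.expGroup (KreinGroup.schrodingerOp hB hP J) t z₀) ∧
      ∀ Z : ℝ → 𝒳,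
        KreinGroup.IsMildSchrodingerSolution (KreinGroup.schrodingerOp hB hP J) Z → Z 0 = z₀ →
          Z = fun t => KreinGroup.expGroup (KreinGroup.schrodingerOp hB hP J) t z₀) ∧
    -- existence and uniqueness for `Ẋ = A X`
    (∀ x₀ : KreinGroup.EnergySpace hB hP,
      KreinGroup.kreinFlow hB hP J 0 x₀ = x₀ ∧
      KreinGroup.IsMildSolution hB hP J (fun t => KreinGroup.kreinFlow hB hP J t x₀) ∧
      ∀ X : ℝ → KreinGroup.EnergySpace hB hP,
        KreinGroup.IsMildSolution hB hP J X → X 0 = x₀ →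
          X = fun t => KreinGroup.kreinFlow hB hP J t x₀) ∧
    -- the dynamical group is a group of unitary operators of `𝒱`
    (∃ V : ℝ → (KreinGroup.EnergySpace hB hP ≃ₗᵢ[ℂ] KreinGroup.EnergySpace hB hP),
      (∀ t x, V t x = KreinGroup.kreinFlow hB hP J t x) ∧
      V 0 = LinearIsometryEquiv.refl ℂ (KreinGroup.EnergySpace hB hP) ∧
      ∀ s t x, V (s + t) x = V s (V t x)) := by
  have hJu : IsUnit (J ^ 2) := (pow_two J).trans hJ2 ▸ isUnit_one.neg
  exact lemma2p3_general B J hB hJ ((isUnit_pow_iff two_ne_zero).mp hJu) hP
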